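/- Let $R$ be an associative ring with $1$ (not necessarily commutative), let $\mathcal{Q}$ be a class of left $R$-modules, and let $M$ be a right $R$-module. A right $R$-module $N$ is called $\mathcal{Q}$-Mittag--Leffler if for every family $(Q_i)_{i\in I}$ of modules from $\mathcal{Q}$ the canonical map $N\otimes_R\prod_{i\in I}Q_i\to\prod_{i\in I}(N\otimes_R Q_i)$ is injective. An $\aleph_1$-dense system in $M$ is a set $\mathcal{C}$ of submodules of $M$, directed under inclusion, which is closed under unions of nonempty well-ordered ascending chains of countable length and such that every countable subset of $M$ is contained in some element of $\mathcal{C}$. The following statements are equivalent: (i) $M$ is $\mathcal{Q}$-Mittag--Leffler. (ii) For every countable subset $X$ of $M$ there is a countably generated $\mathcal{Q}$-Mittag--Leffler submodule $N$ of $M$ containing $X$ such that, with $\varepsilon\colon N\to M$ the inclusion, $\varepsilon\otimes_R Q\colon N\otimes_R Q\to M\otimes_R Q$ is injective for all $Q\in\mathcal{Q}$. (iii) $M$ has an $\aleph_1$-dense system consisting of countably generated $\mathcal{Q}$-Mittag--Leffler modules. (iv) $M$ has an $\aleph_1$-dense system consisting of $\mathcal{Q}$-Mittag--Leffler modules. If,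 in addition, $R\in\mathcal{Q}$, then these statements are further equivalent to (v) $M$ has an $\aleph_1$-dense system consisting of countably presented $\mathcal{Q}$-Mittag--Leffler modules. -/

import Mathlib

open scoped TensorProduct Cardinal

universe u v w

namespace RelML

noncomputable section

section Tensor

variable (R : Type u) [Ring R] (M : Type v) [AddCommGroup M] [Module Rᵐᵒᵖ M]
  (Q : Type w) [AddCommGroup Q] [Module R Q]

/-- The subgroup of `M ⊗_ℤ Q` generated by all `(m r) ⊗ q - m ⊗ (r q)`. A right `R`-module is a
module over `Rᵐᵒᵖ`, so `m r` is written `MulOpposite.op r • m`. -/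
def balancingRelations : AddSubgroup (M ⊗[ℤ] Q) :=
  AddSubgroup.closure
    {t | ∃ (m : M) (r : R) (q : Q), t = (MulOpposite.op r • m) ⊗ₜ[ℤ] q - m ⊗ₜ[ℤ] (r • q)}

/-- The tensor product `M ⊗_R Q` of a right module `M` and a left module `Q` over a ring `R` that
need not be commutative; it is an abelian group. -/
abbrev BalTensor : Type (max v w) := (M ⊗[ℤ] Q) ⧸ balancingRelations R M Q

variable {M Q}

/-- The pure tensor `m ⊗ q` in `M ⊗_R Q`. -/
def BalTensor.tmul (m : M) (q : Q) : BalTensor R M Q :=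
  QuotientAddGroup.mk (m ⊗ₜ[ℤ] q)

theorem BalTensor.smul_tmul (m : M) (r : R) (q : Q) :
    BalTensor.tmul R (MulOpposite.op r • m) q = BalTensor.tmul R m (r • q) :=
  QuotientAddGroup.eq_iff_sub_mem.2 (AddSubgroup.subset_closure ⟨m, r, q, rfl⟩)

end Tensor

section Map

variable {R : Type u} [Ring R] {M M' : Type v} [AddCommGroup M] [Module Rᵐᵒᵖ M]
  [AddCommGroup M'] [Module Rᵐᵒᵖ M'] {Q Q' : Type*} [AddCommGroup Q] [Module R Q]
  [AddCommGroup Q'] [Module R Q']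

theorem balancingRelations_le_comap (f : M →ₗ[Rᵐᵒᵖ] M') (g : Q →ₗ[R] Q') :
    balancingRelations R M Q ≤ (balancingRelations R M' Q').comap
      (TensorProduct.map f.toAddMonoidHom.toIntLinearMap g.toAddMonoidHom.toIntLinearMap).toAddMonoidHom := by
  refine (AddSubgroup.closure_le _).2 ?_
  rintro _ ⟨m, r, q, rfl⟩
  refine AddSubgroup.subset_closure ⟨f m, r, g q, ?_⟩
  simp

/-- The homomorphism `f ⊗_R g`, which sends `m ⊗ q` to `f m ⊗ g q`. -/
def BalTensor.map (f : M →ₗ[Rᵐᵒᵖ] M') (g : Q →ₗ[R] Q') :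
    BalTensor R M Q →+ BalTensor R M' Q' :=
  QuotientAddGroup.map _ _
    (TensorProduct.map f.toAddMonoidHom.toIntLinearMap g.toAddMonoidHom.toIntLinearMap).toAddMonoidHom
    (balancingRelations_le_comap f g)

theorem BalTensor.map_tmul (f : M →ₗ[Rᵐᵒᵖ] M') (g : Q →ₗ[R] Q') (m : M) (q : Q) :
    BalTensor.map f g (BalTensor.tmul R m q) = BalTensor.tmul R (f m) (g q) :=
  rfl

end Map

section MittagLeffler

variable {R : Type u} [Ring R]

/-- The canonical homomorphism `ρ : M ⊗_R ∏ i, F i → ∏ i, M ⊗_R F i`, which sends `m ⊗ (q i)_i` to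
`(m ⊗ q i)_i`. -/
def rho (M : Type u) [AddCommGroup M] [Module Rᵐᵒᵖ M] {I : Type u} (F : I → ModuleCat.{u} R) :
    BalTensor R M (∀ i, F i) →+ ∀ i, BalTensor R M (F i) :=
  AddMonoidHom.pi fun i => BalTensor.map LinearMap.id (LinearMap.proj i)

/-- The right module `M` is `𝒬`-Mittag-Leffler: `ρ` is injective for every family of modules
from `𝒬`. -/
def IsMittagLeffler (𝒬 : Set (ModuleCat.{u} R)) (M : Type u) [AddCommGroup M]
    [Module Rᵐᵒᵖ M] : Prop :=
  ∀ (I : Type u) (F : I → ModuleCat.{u} R), (∀ i, F i ∈ 𝒬) → Function.Injective (rho M F)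

end MittagLeffler

section Modules

variable (A : Type u) [Ring A] (M : Type v) [AddCommGroup M] [Module A M]

/-- `M` is generated by a countable (possibly finite) subset. -/
def CountablyGenerated : Prop :=
  ∃ S : Set M, S.Countable ∧ Submodule.span A S = ⊤

/-- `M` is the quotient of a free module of countable rank by a countably generated submodule. -/
def CountablyPresented : Prop :=
  ∃ f : (ℕ →₀ A) →ₗ[A] M, Function.Surjective f ∧ CountablyGenerated A (LinearMap.ker f)

variable {A M}

/-- `C` is a `κ`-dense system in `M`, for a regular uncountable cardinal `κ`. Nonempty well-ordered
chains of length `< κ` are indexed by nonempty well-ordered sets of cardinality `< κ`; the supremum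
of such a chain of submodules is its union. -/
structure IsDenseSystem (κ : Cardinal.{v}) (C : Set (Submodule A M)) : Prop where
  directed : DirectedOn (· ≤ ·) C
  chain_closed : ∀ (ι : Type v) [LinearOrder ι] [WellFoundedLT ι] [Nonempty ι],
    Cardinal.mk ι < κ → ∀ N : ι → Submodule A M, Monotone N → (∀ i, N i ∈ C) → (⨆ i, N i) ∈ C
  exists_le : ∀ X : Set M, Cardinal.mk X < κ → ∃ N ∈ C, X ⊆ N

end Modules

end

end RelML

/-! A tensor is written as a finitely supported family `t` of coefficients on a family `g` of
generators; it vanishes iff `t` is a combination of relations of `g`. In a Mittag-Leffler module,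
the vanishing tensors on finitely many generators, over all `Q` in `𝒬` at once, are accounted for by
one finite set of relations (`IsMittagLeffler.exists_finset_relations`). Closing a countable set
under the supports of these relations yields (ii) (`IsMittagLeffler.exists_submodule`). The pure,
countably generated Mittag-Leffler submodules survive countable directed unions, whence (iii). If `R
∈ 𝒬`, the same finiteness makes the relation module of countably many generators countably
generated, whence (v).

For (iv) ⇒ (i) the members of the system need not be pure; `IsDenseSystem.isMittagLeffler`
diagonalizes along a countable chain instead. -/

namespace RelML

noncomputable section

/-! ### Tensors as coefficient families on generators -/

section Generators

variable {R : Type u} [Ring R] {M : Type v} [AddCommGroup M] [Module Rᵐᵒᵖ M]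
  {Q : Type w} [AddCommGroup Q] [Module R Q] {α : Type*}

/-- The pure tensor `m ⊗ q` as a biadditive map. -/
def BalTensor.tmulHom : M →+ Q →+ BalTensor R M Q :=
  AddMonoidHom.mk' (fun m => AddMonoidHom.mk' (fun q => BalTensor.tmul R m q)
    fun q q' => by simp [BalTensor.tmul, TensorProduct.tmul_add])
    fun m m' => by ext q; simp [BalTensor.tmul, TensorProduct.add_tmul]

theorem BalTensor.tmulHom_apply (m : M) (q : Q) :
    BalTensor.tmulHom m q = BalTensor.tmul R m q := rfl

/-- The homomorphism on `M ⊗_R Q` induced by a balanced biadditive map. -/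
def BalTensor.lift {P : Type*} [AddCommGroup P] (f : M →+ Q →+ P)
    (hf : ∀ (m : M) (r : R) (q : Q), f (MulOpposite.op r • m) q = f m (r • q)) :
    BalTensor R M Q →+ P :=
  QuotientAddGroup.lift _ (TensorProduct.liftAddHom f fun n m q => by simp) <| by
    refine (AddSubgroup.closure_le _).2 ?_
    rintro _ ⟨m, r, q, rfl⟩
    simp [hf]

theorem BalTensor.lift_tmul {P : Type*} [AddCommGroup P] (f : M →+ Q →+ P)
    (hf : ∀ (m : M) (r : R) (q : Q), f (MulOpposite.op r • m) q = f m (r • q)) (m : M) (q : Q) :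
    BalTensor.lift f hf (BalTensor.tmul R m q) = f m q := rfl

theorem BalTensor.induction_on {p : BalTensor R M Q → Prop} (z : BalTensor R M Q)
    (zero : p 0) (tmul : ∀ m q, p (BalTensor.tmul R m q))
    (add : ∀ x y, p x → p y → p (x + y)) : p z := by
  induction z using QuotientAddGroup.induction_on with
  | H z =>
    induction z using TensorProduct.induction_on with
    | zero => exact zero
    | tmul m q => exact tmul m q
    | add x y hx hy => exact add _ _ hx hy

/-- `s ⊗ q` in `R^(α) ⊗_R Q = Q^(α)`: the family obtained by letting each entry of `s` act
on `q`. -/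
def coeffSMul : (α →₀ Rᵐᵒᵖ) →+ Q →+ (α →₀ Q) :=
  AddMonoidHom.mk' (fun s => AddMonoidHom.mk'
    (fun q => s.mapRange (fun r => r.unop • q) (by simp))
    fun q q' => by ext; simp)
    fun s s' => by ext q : 1; ext a; simp [add_smul]

theorem coeffSMul_apply (s : α →₀ Rᵐᵒᵖ) (q : Q) (a : α) :
    coeffSMul s q a = (s a).unop • q := rfl

theorem support_coeffSMul_subset (s : α →₀ Rᵐᵒᵖ) (q : Q) :
    (coeffSMul s q).support ⊆ s.support :=
  Finsupp.support_mapRange (hf := by simp)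

theorem coeffSMul_single (a : α) (r : Rᵐᵒᵖ) (q : Q) :
    coeffSMul (Finsupp.single a r) q = Finsupp.single a (r.unop • q) := by
  simp [coeffSMul]

theorem coeffSMul_op_smul (s : α →₀ Rᵐᵒᵖ) (r : R) (q : Q) :
    coeffSMul (MulOpposite.op r • s) q = coeffSMul s (r • q) := by
  ext a
  simp [coeffSMul_apply, mul_smul]

/-- The homomorphism `Q^(α) → M ⊗_R Q`, `(q a)_a ↦ ∑ a, g a ⊗ q a`, of a family `g` in `M`. -/
def tensorSum (g : α → M) : (α →₀ Q) →+ BalTensor R M Q :=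
  Finsupp.liftAddHom fun a => BalTensor.tmulHom (g a)

theorem tensorSum_single (g : α → M) (a : α) (q : Q) :
    tensorSum g (Finsupp.single a q) = BalTensor.tmul R (g a) q :=
  Finsupp.sum_single_index (map_zero (BalTensor.tmulHom (g a)))

theorem tensorSum_coeffSMul (g : α → M) (s : α →₀ Rᵐᵒᵖ) (q : Q) :
    tensorSum g (coeffSMul s q) =
      BalTensor.tmul R (Finsupp.linearCombination Rᵐᵒᵖ g s) q := by
  induction s using Finsupp.induction_linear with
  | zero => simp [← BalTensor.tmulHom_apply]
  | add s s' hs hs' =>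
    simp only [map_add, AddMonoidHom.add_apply, hs, hs', ← BalTensor.tmulHom_apply]
  | single a r =>
    rw [coeffSMul_single, tensorSum_single, Finsupp.linearCombination_single,
      ← BalTensor.smul_tmul, MulOpposite.op_unop]

/-- Restricting the support to `Y` lets the elements of `M` index generators of all its submodules
at once. -/
theorem exists_tensorSum_eq {g : α → M} {Y : Set α}
    (hY : Submodule.span Rᵐᵒᵖ (g '' Y) = ⊤) (z : BalTensor R M Q) :
    ∃ t : α →₀ Q, ↑t.support ⊆ Y ∧ tensorSum g t = z := by
  classical
  induction z using BalTensor.induction_on with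
  | zero => exact ⟨0, by simp, by simp⟩
  | tmul m q =>
    obtain ⟨s, hs, rfl⟩ := (Finsupp.mem_span_image_iff_linearCombination Rᵐᵒᵖ).1
      (hY ▸ Submodule.mem_top : m ∈ Submodule.span Rᵐᵒᵖ (g '' Y))
    exact ⟨coeffSMul s q, fun a ha => hs (support_coeffSMul_subset s q ha),
      tensorSum_coeffSMul g s q⟩
  | add x y hx hy =>
    obtain ⟨t, ht, rfl⟩ := hx
    obtain ⟨t', ht', rfl⟩ := hy
    refine ⟨t + t', fun a ha => ?_, map_add _ _ _⟩
    rcases Finset.mem_union.1 (Finsupp.support_add ha) with h | h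
    exacts [ht h, ht' h]

/-- The relations of a family `g` in `M`. -/
abbrev relations (R : Type u) [Ring R] {M : Type v} [AddCommGroup M] [Module Rᵐᵒᵖ M]
    {α : Type*} (g : α → M) : Submodule Rᵐᵒᵖ (α →₀ Rᵐᵒᵖ) :=
  LinearMap.ker (Finsupp.linearCombination Rᵐᵒᵖ g)

/-- Right exactness of the tensor product: `∑ a, g a ⊗ t a` vanishes only if `t` is a combination
of relations of `g`. -/
theorem exists_eq_sum_of_tensorSum_eq_zero {g : α → M}
    (hg : Submodule.span Rᵐᵒᵖ (Set.range g) = ⊤) {t : α →₀ Q}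
    (ht : tensorSum (R := R) g t = 0) :
    ∃ (S : Finset (relations R g)) (p : relations R g → Q),
      t = ∑ s ∈ S, coeffSMul (s : α →₀ Rᵐᵒᵖ) (p s) := by
  let Φ : (relations R g →₀ Q) →+ (α →₀ Q) :=
    Finsupp.liftAddHom fun s => coeffSMul (s : α →₀ Rᵐᵒᵖ)
  let π : (α →₀ Q) →+ (α →₀ Q) ⧸ Φ.range := QuotientAddGroup.mk' _
  have hπ : ∀ s s' : α →₀ Rᵐᵒᵖ, Finsupp.linearCombination Rᵐᵒᵖ g s =
      Finsupp.linearCombination Rᵐᵒᵖ g s' → ∀ q : Q, π (coeffSMul s q) = π (coeffSMul s' q) := by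
    intro s s' h q
    refine QuotientAddGroup.eq_iff_sub_mem.2 ?_
    have hs : s - s' ∈ relations R g := by
      rw [LinearMap.mem_ker, map_sub, h, sub_self]
    refine ⟨Finsupp.single ⟨_, hs⟩ q, ?_⟩
    simp [Φ]
  have hsurj : Function.Surjective (Finsupp.linearCombination Rᵐᵒᵖ g) := by
    rw [← LinearMap.range_eq_top, Finsupp.range_linearCombination, hg]
  -- `σ` is only a set-theoretic section; by `hπ` its choice is invisible modulo `Φ.range`, so `ψ`
  -- is additive and balanced.
  choose σ hσ using hsurj
  let ψ : M →+ Q →+ (α →₀ Q) ⧸ Φ.range :=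
    AddMonoidHom.mk' (fun m => π.comp (coeffSMul (σ m))) fun m m' => by
      ext q
      have := hπ (σ (m + m')) (σ m + σ m') (by simp [hσ]) q
      simpa using this
  have hψ : ∀ (m : M) (r : R) (q : Q), ψ (MulOpposite.op r • m) q = ψ m (r • q) := by
    intro m r q
    have := hπ (σ (MulOpposite.op r • m)) (MulOpposite.op r • σ m) (by simp [hσ]) q
    rwa [coeffSMul_op_smul] at this
  have key : ∀ t : α →₀ Q, BalTensor.lift ψ hψ (tensorSum g t) = π t := by
    intro t
    induction t using Finsupp.induction_linear with
    | zero => simp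
    | add t t' h h' => simp only [map_add, h, h']
    | single a q =>
      rw [tensorSum_single, BalTensor.lift_tmul]
      have := hπ (σ (g a)) (Finsupp.single a 1) (by simp [hσ]) q
      rw [coeffSMul_single, MulOpposite.unop_one, one_smul] at this
      exact this
  have h0 : π t = 0 := by rw [← key, ht, map_zero]
  obtain ⟨P, hP⟩ := (QuotientAddGroup.eq_zero_iff t).1 h0
  exact ⟨P.support, P, hP.symm⟩

theorem tensorSum_sum_coeffSMul_eq_zero {g : α → M} {ι : Type*} (S : Finset ι)
    (s : ι → α →₀ Rᵐᵒᵖ) (hs : ∀ i ∈ S, Finsupp.linearCombination Rᵐᵒᵖ g (s i) = 0) (p : ι → Q) :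
    tensorSum (R := R) g (∑ i ∈ S, coeffSMul (s i) (p i)) = 0 := by
  rw [map_sum]
  refine Finset.sum_eq_zero fun i hi => ?_
  rw [tensorSum_coeffSMul, hs i hi, ← BalTensor.tmulHom_apply]
  simp

theorem map_tensorSum {M' : Type v} [AddCommGroup M'] [Module Rᵐᵒᵖ M'] {Q' : Type*}
    [AddCommGroup Q'] [Module R Q'] (f : M →ₗ[Rᵐᵒᵖ] M') (h : Q →ₗ[R] Q') (g : α → M)
    (g' : α → M') (t : α →₀ Q) (hg : ∀ a ∈ t.support, g' a = f (g a)) :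
    BalTensor.map f h (tensorSum g t) = tensorSum g' (t.mapRange h h.map_zero) := by
  simp only [tensorSum, Finsupp.liftAddHom_apply]
  rw [Finsupp.sum_mapRange_index (by simp), Finsupp.sum, Finsupp.sum, map_sum]
  refine Finset.sum_congr rfl fun a ha => ?_
  rw [hg a ha]
  rfl

theorem map_id_tensorSum {M' : Type v} [AddCommGroup M'] [Module Rᵐᵒᵖ M']
    (f : M →ₗ[Rᵐᵒᵖ] M') (g : α → M)
    (g' : α → M') (t : α →₀ Q) (hg : ∀ a ∈ t.support, g' a = f (g a)) :
    BalTensor.map f (LinearMap.id : Q →ₗ[R] Q) (tensorSum g t) = tensorSum g' t := by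
  rw [map_tensorSum f _ g g' t hg]
  congr 1
  ext; simp

theorem map_id_map_id {M' M'' : Type v} [AddCommGroup M'] [Module Rᵐᵒᵖ M'] [AddCommGroup M'']
    [Module Rᵐᵒᵖ M''] (f : M →ₗ[Rᵐᵒᵖ] M') (f' : M' →ₗ[Rᵐᵒᵖ] M'') (z : BalTensor R M Q) :
    BalTensor.map f' (LinearMap.id : Q →ₗ[R] Q) (BalTensor.map f LinearMap.id z) =
      BalTensor.map (f' ∘ₗ f) LinearMap.id z := by
  induction z using BalTensor.induction_on with
  | zero => simp
  | tmul m q => simp [BalTensor.map_tmul]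
  | add x y hx hy => simp only [map_add, hx, hy]

end Generators

/-! ### Tensors over varying submodules of a fixed module -/

section Submodules

variable {R : Type u} [Ring R] {M : Type v} [AddCommGroup M] [Module Rᵐᵒᵖ M]
  {Q : Type w} [AddCommGroup Q] [Module R Q]

open Classical in
/-- The elements of `M` as a family in the submodule `N`, with `0` for those outside `N`. -/
def truncate (N : Submodule Rᵐᵒᵖ M) (m : M) : N :=
  if h : m ∈ N then ⟨m, h⟩ else 0

theorem coe_truncate {N : Submodule Rᵐᵒᵖ M} {m : M} (h : m ∈ N) : (truncate N m : M) = m := by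
  simp [truncate, h]

theorem truncate_coe {N : Submodule Rᵐᵒᵖ M} (m : N) : truncate N (m : M) = m :=
  Subtype.ext (coe_truncate m.2)

theorem span_truncate_image (G : Set M) :
    Submodule.span Rᵐᵒᵖ (truncate (Submodule.span Rᵐᵒᵖ G) '' G) = ⊤ := by
  refine eq_top_iff.2 <| Submodule.span_span_coe_preimage.symm.le.trans <| Submodule.span_mono ?_
  exact fun m hm => ⟨m, hm, truncate_coe m⟩

theorem span_truncate_image_coe (N : Submodule Rᵐᵒᵖ M) :
    Submodule.span Rᵐᵒᵖ (truncate N '' (N : Set M)) = ⊤ := by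
  refine eq_top_iff.2 fun m _ => Submodule.subset_span ⟨m, m.2, truncate_coe m⟩

theorem linearCombination_truncate_eq_zero {N : Submodule Rᵐᵒᵖ M} {s : M →₀ Rᵐᵒᵖ}
    (hs : s ∈ relations R (id : M → M)) (hN : ∀ m ∈ s.support, m ∈ N) :
    Finsupp.linearCombination Rᵐᵒᵖ (truncate N) s = 0 := by
  refine Subtype.ext ?_
  rw [ZeroMemClass.coe_zero, ← LinearMap.mem_ker.1 hs, Finsupp.linearCombination_apply,
    Finsupp.linearCombination_apply, Finsupp.sum, Finsupp.sum, Submodule.coe_sum]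
  refine Finset.sum_congr rfl fun m hm => ?_
  rw [Submodule.coe_smul, coe_truncate (hN m hm), id]

theorem map_subtype_tensorSum_truncate {N : Submodule Rᵐᵒᵖ M} {t : M →₀ Q}
    (ht : ∀ m ∈ t.support, m ∈ N) :
    BalTensor.map N.subtype (LinearMap.id : Q →ₗ[R] Q) (tensorSum (truncate N) t) =
      tensorSum id t :=
  map_id_tensorSum _ _ _ _ fun m hm => (coe_truncate (ht m hm)).symm

theorem map_inclusion_tensorSum_truncate {N N' : Submodule Rᵐᵒᵖ M} (h : N ≤ N') {t : M →₀ Q}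
    (ht : ∀ m ∈ t.support, m ∈ N) :
    BalTensor.map (Submodule.inclusion h) (LinearMap.id : Q →ₗ[R] Q) (tensorSum (truncate N) t) =
      tensorSum (truncate N') t :=
  map_id_tensorSum _ _ _ _ fun m hm => Subtype.ext <| by
    rw [coe_truncate (h (ht m hm)), Submodule.coe_inclusion, coe_truncate (ht m hm)]

/-- If `∑ m ⊗ t m` vanishes in `U ⊗_R Q`, it vanishes in `N ⊗_R Q` for every submodule `N` which
contains a suitable finite subset of `U`. -/
theorem exists_finset_tensorSum_truncate_eq_zero {U : Submodule Rᵐᵒᵖ M} {t : M →₀ Q}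
    (htU : ∀ m ∈ t.support, m ∈ U) (ht : tensorSum (R := R) (truncate U) t = 0) :
    ∃ Y : Finset M, ↑Y ⊆ (U : Set M) ∧ ∀ N : Submodule Rᵐᵒᵖ M, ↑Y ⊆ (N : Set M) →
      tensorSum (R := R) (truncate N) t = 0 := by
  classical
  have hspan : Submodule.span Rᵐᵒᵖ (Set.range (truncate U)) = ⊤ :=
    eq_top_iff.2 fun m _ => Submodule.subset_span ⟨m, truncate_coe m⟩
  obtain ⟨S, p, hS⟩ := exists_eq_sum_of_tensorSum_eq_zero hspan ht
  -- `truncate U` is `0` outside `U`, so dropping those coefficients leaves a genuine relation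
  -- between elements of `M`.
  let σ (s : relations R (truncate U)) : M →₀ Rᵐᵒᵖ := (s : M →₀ Rᵐᵒᵖ).filter (· ∈ U)
  have hσU (s : relations R (truncate U)) (m : M) (hm : m ∈ (σ s).support) : m ∈ U :=
    (Finset.mem_filter.1 hm).2
  have hσ (s : relations R (truncate U)) : σ s ∈ relations R (id : M → M) := by
    have hs : ((Finsupp.linearCombination Rᵐᵒᵖ (truncate U) (s : M →₀ Rᵐᵒᵖ) : U) : M) = 0 := by
      rw [LinearMap.mem_ker.1 s.2, ZeroMemClass.coe_zero]
    rw [LinearMap.mem_ker, ← hs, Finsupp.linearCombination_apply, Finsupp.linearCombination_apply,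
      Finsupp.sum, Finsupp.sum, Submodule.coe_sum, Finsupp.support_filter, Finset.sum_filter]
    refine Finset.sum_congr rfl fun m _ => ?_
    by_cases hm : m ∈ U <;> simp [σ, hm, truncate]
  have htσ : t = ∑ s ∈ S, coeffSMul (σ s) (p s) := by
    ext m
    rw [Finsupp.finsetSum_apply]
    by_cases hm : m ∈ U
    · rw [hS, Finsupp.finsetSum_apply]
      refine Finset.sum_congr rfl fun s _ => ?_
      simp [coeffSMul_apply, σ, hm]
    · rw [Finsupp.notMem_support_iff.1 fun h => hm (htU m h)]
      refine (Finset.sum_eq_zero fun s _ => ?_).symm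
      simp [coeffSMul_apply, σ, hm]
  refine ⟨S.biUnion fun s => (σ s).support, fun m hm => ?_, fun N hN => ?_⟩
  · obtain ⟨s, -, hs⟩ := Finset.mem_biUnion.1 hm
    exact hσU s m hs
  · rw [htσ]
    refine tensorSum_sum_coeffSMul_eq_zero S σ (fun s hs => ?_) p
    exact linearCombination_truncate_eq_zero (hσ s) fun m hm =>
      hN (Finset.mem_biUnion.2 ⟨s, hs, hm⟩)

theorem tensorSum_truncate_top_eq_zero {t : M →₀ Q} (ht : tensorSum (R := R) (id : M → M) t = 0) :
    tensorSum (R := R) (truncate (⊤ : Submodule Rᵐᵒᵖ M)) t = 0 := by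
  rw [← map_id_tensorSum (Submodule.topEquiv.symm : M ≃ₗ[Rᵐᵒᵖ] _).toLinearMap id, ht, map_zero]
  exact fun m _ => Subtype.ext (coe_truncate Submodule.mem_top)

end Submodules

/-! ### Finiteness of relations in Mittag-Leffler modules -/

section MittagLeffler

variable {R : Type u} [Ring R] {𝒬 : Set (ModuleCat.{u} R)} {M : Type u} [AddCommGroup M]
  [Module Rᵐᵒᵖ M]

theorem rho_tensorSum {α : Type*} (g : α → M) {I : Type u} (F : I → ModuleCat.{u} R)
    (t : α →₀ ∀ i, F i) (i : I) :
    rho M F (tensorSum g t) i =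
      tensorSum g (t.mapRange (LinearMap.proj (R := R) i) (map_zero _)) :=
  map_tensorSum _ _ _ _ _ fun _ _ => rfl

theorem isMittagLeffler_iff : IsMittagLeffler 𝒬 M ↔
    ∀ (I : Type u) (F : I → ModuleCat.{u} R), (∀ i, F i ∈ 𝒬) →
      ∀ z : BalTensor R M (∀ i, F i), (∀ i, rho M F z i = 0) → z = 0 :=
  forall_congr' fun I => forall_congr' fun F => forall_congr' fun _ =>
    (injective_iff_map_eq_zero _).trans <| forall_congr' fun _ => by rw [funext_iff]; rfl

theorem map_rho {M' : Type u} [AddCommGroup M'] [Module Rᵐᵒᵖ M'] (f : M →ₗ[Rᵐᵒᵖ] M') {I : Type u}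
    (F : I → ModuleCat.{u} R) (z : BalTensor R M (∀ i, F i)) (i : I) :
    BalTensor.map f LinearMap.id (rho M F z i) = rho M' F (BalTensor.map f LinearMap.id z) i := by
  induction z using BalTensor.induction_on with
  | zero => simp
  | tmul m q => rfl
  | add x y hx hy => simp only [map_add, Pi.add_apply, hx, hy]

/-- In a Mittag-Leffler module the tensors on finitely many elements of a generating family that
vanish for some module from `𝒬` vanish because of finitely many relations. -/
theorem IsMittagLeffler.exists_finset_relations (hM : IsMittagLeffler 𝒬 M) {α : Type*} {g : α → M}
    (hg : Submodule.span Rᵐᵒᵖ (Set.range g) = ⊤) {I : Type u} (e : I ≃ Finset (relations R g))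
    (Y : Finset α) :
    ∃ S : Finset (relations R g), ∀ Q ∈ 𝒬, ∀ t : α →₀ Q, t.support ⊆ Y →
      tensorSum (R := R) g t = 0 →
      ∃ p : relations R g → Q, t = ∑ s ∈ S, coeffSMul (s : α →₀ Rᵐᵒᵖ) (p s) := by
  classical
  by_contra! h
  -- One counterexample for each finite set of relations; the common finite support `Y` lets them
  -- form a single tensor `T` over the product.
  choose F hF t htY ht0 ht using fun i : I => h (e i)
  let T : α →₀ ∀ i, F i := Finsupp.onFinset Y (fun a i => t i a) fun a ha => by
    by_contra haY
    exact ha (funext fun i => Finsupp.notMem_support_iff.1 fun h' => haY (htY i h'))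
  have hT : ∀ i, T.mapRange (LinearMap.proj (R := R) i) (map_zero _) = t i := fun i => by
    ext a; rfl
  have hT0 : tensorSum (R := R) g T = 0 := by
    refine isMittagLeffler_iff.1 hM I F hF _ fun i => ?_
    rw [rho_tensorSum, hT, ht0]
  obtain ⟨S, p, hp⟩ := exists_eq_sum_of_tensorSum_eq_zero hg hT0
  -- The finite set that kills `T` is itself an index, and the component there contradicts its
  -- choice.
  obtain ⟨i, rfl⟩ := e.surjective S
  refine ht i (fun s => p s i) ?_
  ext a
  have := congrFun (DFunLike.congr_fun hp a) i
  rw [Finsupp.finsetSum_apply, Finset.sum_apply] at this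
  rw [Finsupp.finsetSum_apply]
  exact this

/-- For `Q = R` a vanishing tensor is itself a relation, so the finite sets of relations attached to
the finite subsets of `ℕ` together generate all relations. -/
theorem CountablyGenerated.countablyPresented (hM : IsMittagLeffler 𝒬 M)
    (hR : ModuleCat.of R R ∈ 𝒬) (h : CountablyGenerated Rᵐᵒᵖ M) :
    CountablyPresented Rᵐᵒᵖ M := by
  obtain ⟨S, hS, hspan⟩ := h
  -- Adding `0` makes the generating set nonempty, so that `ℕ` can enumerate it.
  obtain ⟨g, hgS⟩ := (hS.insert 0).exists_eq_range (Set.insert_nonempty 0 S)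
  have hg : Submodule.span Rᵐᵒᵖ (Set.range g) = ⊤ :=
    eq_top_iff.2 <| hspan ▸ Submodule.span_mono (hgS ▸ Set.subset_insert 0 S)
  refine ⟨Finsupp.linearCombination Rᵐᵒᵖ g, ?_, ?_⟩
  · rw [← LinearMap.range_eq_top, Finsupp.range_linearCombination, hg]
  choose T hT using fun Y => hM.exists_finset_relations hg (Equiv.refl _) Y
  refine ⟨⋃ Y, ↑(T Y), Set.countable_iUnion fun Y => (T Y).countable_toSet, ?_⟩
  refine eq_top_iff.2 fun s _ => ?_
  let t : ℕ →₀ R := coeffSMul (s : ℕ →₀ Rᵐᵒᵖ) 1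
  have ht : tensorSum (R := R) g t = 0 := by
    rw [tensorSum_coeffSMul, LinearMap.mem_ker.1 s.2, ← BalTensor.tmulHom_apply]
    simp
  obtain ⟨p, hp⟩ := hT t.support _ hR t subset_rfl ht
  have hs : s = ∑ i ∈ T t.support, MulOpposite.op (p i) • i := by
    ext a
    have := DFunLike.congr_fun hp a
    rw [Finsupp.finsetSum_apply] at this
    rw [Submodule.coe_sum, Finsupp.finsetSum_apply]
    refine MulOpposite.unop_injective ?_
    simpa [t, coeffSMul_apply] using this
  rw [hs]
  exact Submodule.sum_mem _ fun i hi =>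
    Submodule.smul_mem _ _ (Submodule.subset_span (Set.mem_iUnion.2 ⟨_, hi⟩))

end MittagLeffler

/-! ### Countably generated pure submodules -/

/-- A finite subset of the union of the stages lies in one stage, and the next stage absorbs its
image under `c`. -/
theorem exists_countable_closed_superset {M : Type*} (c : Finset M → Finset M) {X : Set M}
    (hX : X.Countable) :
    ∃ G : Set M, X ⊆ G ∧ G.Countable ∧ ∀ Y : Finset M, ↑Y ⊆ G → ↑(c Y) ⊆ G := by
  let next : Set M → Set M := fun G => G ∪ ⋃ Y ∈ {Y : Finset M | ↑Y ⊆ G}, ↑(c Y)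
  let G : ℕ → Set M := fun n => next^[n] X
  have hsucc : ∀ n, G (n + 1) = next (G n) := fun n => Function.iterate_succ_apply' _ _ _
  have hmono : Monotone G := monotone_nat_of_le_succ fun n => hsucc n ▸ Set.subset_union_left
  refine ⟨⋃ n, G n, Set.subset_iUnion G 0, Set.countable_iUnion fun n => ?_, fun Y hY => ?_⟩
  · induction n with
    | zero => exact hX
    | succ n ih =>
      rw [hsucc]
      refine ih.union (Set.Countable.biUnion ?_ fun Y _ => (c Y).countable_toSet)
      refine Set.countable_of_injective_of_countable_image Finset.coe_injective.injOn
        ((Set.countable_ofPred_finite_subset ih).mono ?_)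
      rintro _ ⟨Y, hY, rfl⟩
      exact ⟨Y.finite_toSet, hY⟩
  · obtain ⟨n, hn⟩ := hmono.directed_le.exists_mem_subset_of_finset_subset_biUnion hY
    refine Set.Subset.trans ?_ (Set.subset_iUnion G (n + 1))
    rw [hsucc]
    exact Set.Subset.trans (Set.subset_biUnion_of_mem (u := fun Y => (↑(c Y) : Set M)) hn)
      Set.subset_union_right

variable {R : Type u} [Ring R] {𝒬 : Set (ModuleCat.{u} R)} {M : Type u} [AddCommGroup M]
  [Module Rᵐᵒᵖ M]

/-- `N ⊗_R Q → M ⊗_R Q` is injective for all `Q` in `𝒬`. -/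
def IsTensorPure (𝒬 : Set (ModuleCat.{u} R)) (N : Submodule Rᵐᵒᵖ M) : Prop :=
  ∀ Q ∈ 𝒬, Function.Injective (BalTensor.map N.subtype (LinearMap.id : Q →ₗ[R] Q))

/-- The relations needed for tensors on finite subsets of `G` involve only elements of `G`, so a
tensor on `G` that vanishes over `M` already vanishes over `N`. -/
theorem IsMittagLeffler.exists_submodule (hM : IsMittagLeffler 𝒬 M) {X : Set M}
    (hX : X.Countable) :
    ∃ N : Submodule Rᵐᵒᵖ M, X ⊆ N ∧ CountablyGenerated Rᵐᵒᵖ N ∧ IsMittagLeffler 𝒬 N ∧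
      IsTensorPure 𝒬 N := by
  classical
  choose S hS using fun Y => hM.exists_finset_relations (g := (id : M → M)) (by simp)
    (Equiv.refl _) Y
  obtain ⟨G, hXG, hG, hc⟩ := exists_countable_closed_superset
    (fun Y => (S Y).biUnion fun s => (s : M →₀ Rᵐᵒᵖ).support) hX
  set N := Submodule.span Rᵐᵒᵖ G with hN
  have hGN : G ⊆ N := Submodule.subset_span
  have hSN : ∀ Y : Finset M, ↑Y ⊆ G → ∀ s ∈ S Y,
      Finsupp.linearCombination Rᵐᵒᵖ (truncate N) (s : M →₀ Rᵐᵒᵖ) = 0 := fun Y hY s hs =>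
    linearCombination_truncate_eq_zero s.2 fun m hm =>
      hGN (hc Y hY (Finset.mem_biUnion.2 ⟨s, hs, hm⟩))
  refine ⟨N, hXG.trans hGN, ⟨truncate N '' G, hG.image _, span_truncate_image G⟩, ?_, ?_⟩
  · refine isMittagLeffler_iff.2 fun I F hF z hz => ?_
    obtain ⟨t, htG, rfl⟩ := exists_tensorSum_eq (span_truncate_image G) z
    have hsup (i : I) : (t.mapRange (LinearMap.proj (R := R) i) (map_zero _)).support ⊆ t.support :=
      Finsupp.support_mapRange (hf := map_zero _)
    have key (i : I) : ∃ p : relations R (id : M → M) → F i,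
        t.mapRange (LinearMap.proj (R := R) i) (map_zero _) =
          ∑ s ∈ S t.support, coeffSMul (s : M →₀ Rᵐᵒᵖ) (p s) := by
      refine hS t.support _ (hF i) _ (hsup i) ?_
      rw [← map_subtype_tensorSum_truncate (N := N) fun m hm => hGN (htG (hsup i hm)),
        ← rho_tensorSum, hz, map_zero]
    -- `S t.support` does not depend on `i`, so the coefficients assemble into elements of the
    -- product.
    choose p hp using key
    have ht : t = ∑ s ∈ S t.support, coeffSMul (s : M →₀ Rᵐᵒᵖ) (fun i => p i s) := by
      ext a i
      have := DFunLike.congr_fun (hp i) a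
      rw [Finsupp.finsetSum_apply] at this
      rw [Finsupp.finsetSum_apply, Finset.sum_apply]
      exact this
    rw [ht]
    exact tensorSum_sum_coeffSMul_eq_zero _ _ (hSN _ htG) _
  · refine fun Q hQ => (injective_iff_map_eq_zero _).2 fun z hz => ?_
    obtain ⟨t, htG, rfl⟩ := exists_tensorSum_eq (span_truncate_image G) z
    rw [map_subtype_tensorSum_truncate fun m hm => hGN (htG hm)] at hz
    obtain ⟨p, hp⟩ := hS t.support Q hQ t subset_rfl hz
    rw [hp]
    exact tensorSum_sum_coeffSMul_eq_zero _ _ (hSN _ htG) _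

/-! ### Directed unions and dense systems -/

theorem IsTensorPure.injective_map_inclusion {N N' : Submodule Rᵐᵒᵖ M}
    (hN : IsTensorPure 𝒬 N) (h : N ≤ N') {Q : ModuleCat.{u} R} (hQ : Q ∈ 𝒬) :
    Function.Injective (BalTensor.map (Submodule.inclusion h) (LinearMap.id : Q →ₗ[R] Q)) := by
  refine (injective_iff_map_eq_zero _).2 fun z hz => ?_
  refine (injective_iff_map_eq_zero _).1 (hN Q hQ) z ?_
  have := map_id_map_id (Submodule.inclusion h) N'.subtype z
  rw [hz, map_zero, Submodule.subtype_comp_inclusion] at this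
  exact this.symm

/-- Every element of `(⋃ i, N i) ⊗_R Q` comes from some `N i ⊗_R Q`. -/
theorem exists_map_inclusion_eq {ι : Type*} [Nonempty ι] {N : ι → Submodule Rᵐᵒᵖ M}
    (hN : Directed (· ≤ ·) N) {Q : Type*} [AddCommGroup Q] [Module R Q]
    (z : BalTensor R (⨆ i, N i : Submodule Rᵐᵒᵖ M) Q) :
    ∃ (i : ι) (y : BalTensor R (N i) Q),
      BalTensor.map (Submodule.inclusion (le_iSup N i)) LinearMap.id y = z := by
  obtain ⟨t, ht, rfl⟩ := exists_tensorSum_eq (span_truncate_image_coe (⨆ i, N i)) z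
  rw [Submodule.coe_iSup_of_directed N hN] at ht
  have hN' : Directed (· ⊆ ·) fun i => (N i : Set M) := hN
  obtain ⟨i, hi⟩ := hN'.exists_mem_subset_of_finset_subset_biUnion ht
  exact ⟨i, _, map_inclusion_tensorSum_truncate _ fun m hm => hi hm⟩

theorem IsTensorPure.iSup {ι : Type*} [Nonempty ι] {N : ι → Submodule Rᵐᵒᵖ M}
    (hN : Directed (· ≤ ·) N) (h : ∀ i, IsTensorPure 𝒬 (N i)) : IsTensorPure 𝒬 (⨆ i, N i) := by
  refine fun Q hQ => (injective_iff_map_eq_zero _).2 fun z hz => ?_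
  obtain ⟨i, y, rfl⟩ := exists_map_inclusion_eq hN z
  rw [map_id_map_id, Submodule.subtype_comp_inclusion] at hz
  rw [(injective_iff_map_eq_zero _).1 (h i Q hQ) y hz, map_zero]

/-- The tensor comes from some `N i`; purity of `N i` forces its components to vanish there already.
-/
theorem IsMittagLeffler.iSup {ι : Type*} [Nonempty ι] {N : ι → Submodule Rᵐᵒᵖ M}
    (hN : Directed (· ≤ ·) N) (hp : ∀ i, IsTensorPure 𝒬 (N i))
    (h : ∀ i, IsMittagLeffler 𝒬 (N i)) :
    IsMittagLeffler 𝒬 (⨆ i, N i : Submodule Rᵐᵒᵖ M) := by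
  refine isMittagLeffler_iff.2 fun I F hF z hz => ?_
  obtain ⟨i, y, rfl⟩ := exists_map_inclusion_eq hN z
  rw [isMittagLeffler_iff.1 (h i) I F hF y fun k => ?_, map_zero]
  refine (injective_iff_map_eq_zero _).1
    ((hp i).injective_map_inclusion (le_iSup N i) (hF k)) _ ?_
  rw [map_rho, hz]

theorem countablyGenerated_iff_exists_span_eq {N : Submodule Rᵐᵒᵖ M} :
    CountablyGenerated Rᵐᵒᵖ N ↔ ∃ G : Set M, G.Countable ∧ Submodule.span Rᵐᵒᵖ G = N := by
  constructor
  · rintro ⟨S, hS, hspan⟩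
    refine ⟨N.subtype '' S, hS.image _, ?_⟩
    rw [← Submodule.map_span, hspan, Submodule.map_subtype_top]
  · rintro ⟨G, hG, rfl⟩
    exact ⟨truncate _ '' G, hG.image _, span_truncate_image G⟩

theorem CountablyGenerated.iSup {ι : Type*} [Countable ι] {N : ι → Submodule Rᵐᵒᵖ M}
    (h : ∀ i, CountablyGenerated Rᵐᵒᵖ (N i)) :
    CountablyGenerated Rᵐᵒᵖ (⨆ i, N i : Submodule Rᵐᵒᵖ M) := by
  choose G hG hspan using fun i => countablyGenerated_iff_exists_span_eq.1 (h i)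
  refine countablyGenerated_iff_exists_span_eq.2 ⟨⋃ i, G i, Set.countable_iUnion hG, ?_⟩
  rw [Submodule.span_iUnion]
  exact iSup_congr hspan

theorem mk_lt_aleph_one_iff {α : Type*} : #α < ℵ₁ ↔ Countable α := by
  rw [← Cardinal.succ_aleph0, Order.lt_succ_iff, Cardinal.mk_le_aleph0_iff]

/-- The pure countably generated Mittag-Leffler submodules form a dense system as soon as they
contain all countable subsets. -/
theorem isDenseSystem_pure_mittagLeffler (h : ∀ X : Set M, X.Countable → ∃ N : Submodule Rᵐᵒᵖ M,
      X ⊆ N ∧ CountablyGenerated Rᵐᵒᵖ N ∧ IsMittagLeffler 𝒬 N ∧ IsTensorPure 𝒬 N) :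
    IsDenseSystem ℵ₁ {N : Submodule Rᵐᵒᵖ M |
      CountablyGenerated Rᵐᵒᵖ N ∧ IsMittagLeffler 𝒬 N ∧ IsTensorPure 𝒬 N} where
  directed := by
    rintro N₁ ⟨h₁, -⟩ N₂ ⟨h₂, -⟩
    obtain ⟨G₁, hG₁, rfl⟩ := countablyGenerated_iff_exists_span_eq.1 h₁
    obtain ⟨G₂, hG₂, rfl⟩ := countablyGenerated_iff_exists_span_eq.1 h₂
    obtain ⟨N, hGN, hN⟩ := h _ (hG₁.union hG₂)
    exact ⟨N, hN, Submodule.span_le.2 (Set.subset_union_left.trans hGN),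
      Submodule.span_le.2 (Set.subset_union_right.trans hGN)⟩
  chain_closed := by
    intro ι _ _ _ hι N hmono hN
    have := mk_lt_aleph_one_iff.1 hι
    exact ⟨.iSup fun i => (hN i).1,
      .iSup hmono.directed_le (fun i => (hN i).2.2) fun i => (hN i).2.1,
      .iSup hmono.directed_le fun i => (hN i).2.2⟩
  exists_le := by
    intro X hX
    obtain ⟨N, hXN, hN⟩ := h X (mk_lt_aleph_one_iff.1 hX)
    exact ⟨N, hN, hXN⟩

theorem IsDenseSystem.exists_ge {A : Type u} [Ring A] {M : Type v} [AddCommGroup M] [Module A M]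
    {C : Set (Submodule A M)} (hC : IsDenseSystem ℵ₁ C) {N : Submodule A M} (hN : N ∈ C)
    (Y : Finset M) : ∃ N' ∈ C, N ≤ N' ∧ ↑Y ⊆ (N' : Set M) := by
  obtain ⟨N₁, hN₁, hY⟩ := hC.exists_le Y (mk_lt_aleph_one_iff.2 inferInstance)
  obtain ⟨N', hN', h, h₁⟩ := hC.directed N hN N₁ hN₁
  exact ⟨N', hN', h, hY.trans h₁⟩

/-- A module with an `ℵ₁`-dense system of Mittag-Leffler submodules is Mittag-Leffler: otherwise a
tensor whose components vanish in `M` keeps nonzero components along an increasing sequence in the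
system, contrary to the union of the sequence being Mittag-Leffler. -/
theorem IsDenseSystem.isMittagLeffler {C : Set (Submodule Rᵐᵒᵖ M)} (hC : IsDenseSystem ℵ₁ C)
    (hML : ∀ N ∈ C, IsMittagLeffler 𝒬 N) : IsMittagLeffler 𝒬 M := by
  refine isMittagLeffler_iff.2 fun I F hF z hz => ?_
  obtain ⟨t, -, rfl⟩ := exists_tensorSum_eq (g := (id : M → M)) (Y := Set.univ) (by simp) z
  by_contra hne
  let comp (i : I) : M →₀ F i := t.mapRange (LinearMap.proj (R := R) i) (map_zero _)
  have hcomp (i : I) : tensorSum (R := R) (id : M → M) (comp i) = 0 := by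
    rw [← hz i, rho_tensorSum]
  have hsupp (i : I) : (comp i).support ⊆ t.support :=
    Finsupp.support_mapRange (hf := map_zero _)
  let D := {N : Submodule Rᵐᵒᵖ M // N ∈ C ∧ ↑t.support ⊆ (N : Set M)}
  -- If all components vanished over `N`, the tensor would vanish over `N`, hence over `M`.
  have hnonzero (N : D) : ∃ i, tensorSum (R := R) (truncate N.1) (comp i) ≠ 0 := by
    by_contra! h
    refine hne ?_
    rw [← map_subtype_tensorSum_truncate (N := N.1) fun m hm => N.2.2 hm,
      isMittagLeffler_iff.1 (hML N.1 N.2.1) I F hF _ fun i => (rho_tensorSum _ F t i).trans (h i),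
      map_zero]
  choose index hindex using hnonzero
  have hnext (N : D) : ∃ N' : D, N.1 ≤ N'.1 ∧
      tensorSum (R := R) (truncate N'.1) (comp (index N)) = 0 := by
    obtain ⟨Y, -, hY⟩ := exists_finset_tensorSum_truncate_eq_zero (fun _ _ => Submodule.mem_top)
      (tensorSum_truncate_top_eq_zero (hcomp (index N)))
    obtain ⟨N', hN', hle, hYN'⟩ := hC.exists_ge N.2.1 Y
    exact ⟨⟨N', hN', N.2.2.trans hle⟩, hle, hY N' hYN'⟩
  choose next hle hkill using hnext
  obtain ⟨N₀, hN₀, htN₀⟩ := hC.exists_le t.support (mk_lt_aleph_one_iff.2 inferInstance)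
  let seq (n : ℕ) : D := next^[n] ⟨N₀, hN₀, htN₀⟩
  have hseq (n : ℕ) : seq (n + 1) = next (seq n) := Function.iterate_succ_apply' _ _ _
  have hmono : Monotone fun n => (seq n).1 := monotone_nat_of_le_succ fun n => hseq n ▸ hle _
  let chain (n : ULift.{u} ℕ) : Submodule Rᵐᵒᵖ M := (seq n.down).1
  have hchain : Monotone chain := fun _ _ h => hmono h
  let U := ⨆ n, chain n
  have hU : U ∈ C := hC.chain_closed _ (mk_lt_aleph_one_iff.2 inferInstance) chain hchain
    fun n => (seq n.down).2.1
  have hleU (n : ℕ) : (seq n).1 ≤ U := le_iSup chain ⟨n⟩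
  -- The modules whose components were chosen along the sequence: the `n`th is nonzero at stage `n`
  -- and dies at stage `n + 1`, hence over `U`.
  let F' (n : ULift.{u} ℕ) : ModuleCat.{u} R := F (index (seq n.down))
  let t' : M →₀ ∀ n, F' n := t.mapRange (fun q n => q (index (seq n.down))) rfl
  have ht' (n : ULift.{u} ℕ) : t'.mapRange (LinearMap.proj (R := R) n) (map_zero _) =
      comp (index (seq n.down)) := by
    ext m
    rfl
  have ht't : t'.support ⊆ t.support := Finsupp.support_mapRange (hf := rfl)
  have hkill' (n : ℕ) : tensorSum (R := R) (truncate (seq (n + 1)).1) (comp (index (seq n))) = 0 := by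
    rw [hseq]
    exact hkill _
  have hzero : tensorSum (R := R) (truncate U) t' = 0 := by
    refine isMittagLeffler_iff.1 (hML U hU) _ F' (fun n => hF _) _ fun n => ?_
    rw [rho_tensorSum, ht', ← map_inclusion_tensorSum_truncate (hleU (n.down + 1))
      fun m hm => (seq _).2.2 (hsupp _ hm), hkill', map_zero]
  obtain ⟨Y, hYU, hY⟩ := exists_finset_tensorSum_truncate_eq_zero
    (fun m hm => hleU 0 ((seq 0).2.2 (ht't hm))) hzero
  rw [Submodule.coe_iSup_of_directed chain hchain.directed_le] at hYU
  have hdir : Directed (· ⊆ ·) fun n => (chain n : Set M) := hchain.directed_le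
  obtain ⟨n, hn⟩ := hdir.exists_mem_subset_of_finset_subset_biUnion hYU
  -- Finitely many elements witness the vanishing over `U`, so it holds at some stage `n`, where the
  -- `n`th component is nonzero.
  refine hindex (seq n.down) ?_
  rw [← ht', ← rho_tensorSum (F := F'), hY _ hn, map_zero, Pi.zero_apply]

end

end RelML

theorem mainTheorem2 {R : Type u} [Ring R] (𝒬 : Set (ModuleCat.{u} R))
    (M : Type u) [AddCommGroup M] [Module Rᵐᵒᵖ M] :
    List.TFAE
      [ -- (i)
        RelML.IsMittagLeffler 𝒬 M,
        -- (ii)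
        ∀ X : Set M, X.Countable → ∃ N : Submodule Rᵐᵒᵖ M,
          X ⊆ N ∧ RelML.CountablyGenerated Rᵐᵒᵖ N ∧ RelML.IsMittagLeffler 𝒬 N ∧
          ∀ Q ∈ 𝒬, Function.Injective
            (RelML.BalTensor.map N.subtype (LinearMap.id : Q →ₗ[R] Q)),
        -- (iii)
        ∃ C : Set (Submodule Rᵐᵒᵖ M), RelML.IsDenseSystem (Cardinal.aleph 1) C ∧
          ∀ N ∈ C, RelML.CountablyGenerated Rᵐᵒᵖ N ∧ RelML.IsMittagLeffler 𝒬 N,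
        -- (iv)
        ∃ C : Set (Submodule Rᵐᵒᵖ M), RelML.IsDenseSystem (Cardinal.aleph 1) C ∧
          ∀ N ∈ C, RelML.IsMittagLeffler 𝒬 N ] ∧
    (ModuleCat.of R R ∈ 𝒬 →
      -- (i) ↔ (v)
      (RelML.IsMittagLeffler 𝒬 M ↔
        ∃ C : Set (Submodule Rᵐᵒᵖ M), RelML.IsDenseSystem (Cardinal.aleph 1) C ∧
          ∀ N ∈ C, RelML.CountablyPresented Rᵐᵒᵖ N ∧ RelML.IsMittagLeffler 𝒬 N)) := by
  have h12 : RelML.IsMittagLeffler 𝒬 M → ∀ X : Set M, X.Countable →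
      ∃ N : Submodule Rᵐᵒᵖ M, X ⊆ N ∧ RelML.CountablyGenerated Rᵐᵒᵖ N ∧
        RelML.IsMittagLeffler 𝒬 N ∧ RelML.IsTensorPure 𝒬 N := fun hM _ hX =>
    hM.exists_submodule hX
  refine ⟨?_, fun hR => ⟨fun hM => ?_, fun ⟨C, hC, h⟩ =>
    hC.isMittagLeffler fun N hN => (h N hN).2⟩⟩
  · tfae_have 1 → 2 := h12
    tfae_have 2 → 3 := fun h => ⟨_, RelML.isDenseSystem_pure_mittagLeffler h, fun N hN => ⟨hN.1, hN.2.1⟩⟩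
    tfae_have 3 → 4 := fun ⟨C, hC, h⟩ => ⟨C, hC, fun N hN => (h N hN).2⟩
    tfae_have 4 → 1 := fun ⟨C, hC, h⟩ => hC.isMittagLeffler h
    tfae_finish
  · exact ⟨_, RelML.isDenseSystem_pure_mittagLeffler (h12 hM), fun N hN =>
      ⟨hN.1.countablyPresented hN.2.1 hR, hN.2.1⟩⟩
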